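/- For $n\ge 0$ let $p_n(b)\in\mathbb{Q}[b]$ be defined by the identity of formal power series in $q$ $$\prod_{k\ge 1}(1-q^k)^{b-1}=\sum_{n\ge 0}\frac{q^n}{n!}\,p_n(b).$$ Then every $p_n(b)$ has integer coefficients. Say that the coefficients of $f(b)=\sum_t c_t b^t\in\mathbb{Z}[b]$ equally populate the nonzero residue classes mod $p$ if the number of $t$ with $c_t\equiv r \pmod p$ is the same for all $r\not\equiv 0 \pmod p$. Let $p$ be a prime. (1) If the number of partitions of $p-1$ is not congruent to $1$ mod $p$, then for every $n\ge 0$ with $n\equiv -p-1 \pmod{p^2}$ the coefficients of $p_n(b)$ equally populate the nonzero residue classes mod $p$. (2) If the number of partitions of $p-1$ is congruent to $1$ mod $p$, then for every $n\ge 0$ with $n\equiv -p^2-p-1 \pmod{p^3}$ the coefficients of $p_n(b)$ equally populate the nonzero residue classes mod $p$. -/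

import Mathlib

open Polynomial

/-- The generalized binomial coefficient `binom(b - 1, i) = (b - 1)(b - 2) ⋯ (b - i) / i!`,
as a polynomial in the indeterminate `b = X`. -/
noncomputable def binomBSubOne (i : ℕ) : ℚ[X] :=
  C ((i.factorial : ℚ)⁻¹) * (descPochhammer ℚ i).comp (X - 1)

/-- The formal power series `(1 - q ^ k) ^ (b - 1) = ∑ i, binom(b - 1, i) (-1) ^ i q ^ (k i)` in `q`
(for `k ≥ 1`), with coefficients in `ℚ[b]`. -/
noncomputable def etaFactor (k : ℕ) : PowerSeries ℚ[X] :=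
  PowerSeries.mk fun m => if k ∣ m then (-1) ^ (m / k) * binomBSubOne (m / k) else 0

/-- The formal infinite product `∏_{k ≥ 1} (1 - q ^ k) ^ (b - 1)` in `ℚ[b]⟦q⟧`. The factors with
`k > n` do not affect the coefficient of `q ^ n`, so that coefficient is the one in the product of
the first `n` factors; see `coeff_etaPower`. -/
noncomputable def etaPower : PowerSeries ℚ[X] :=
  PowerSeries.mk fun n => PowerSeries.coeff n (∏ k ∈ Finset.Icc 1 n, etaFactor k)

/-- The coefficient of `q ^ n` in the partial products is eventually constant, and its eventual
value is the coefficient of `etaPower`. -/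
theorem coeff_etaPower (n N : ℕ) (h : n ≤ N) :
    PowerSeries.coeff n (∏ k ∈ Finset.Icc 1 N, etaFactor k) = PowerSeries.coeff n etaPower := by
  induction N, h using Nat.le_induction with
  | base => simp [etaPower]
  | succ N hN ih =>
    rw [Finset.prod_Icc_succ_top (by omega), PowerSeries.coeff_mul, ← ih,
      Finset.sum_eq_single (n, 0)]
    · simp [etaFactor, binomBSubOne]
    · rintro ⟨a, c⟩ hac hne
      have hac : a + c = n := by simpa using hac
      have hc : 0 < c := by
        rcases Nat.eq_zero_or_pos c with rfl | hc
        · exact absurd (by simpa using hac) hne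
        · exact hc
      have hnd : ¬ (N + 1 ∣ c) := fun hd => by
        have := Nat.le_of_dvd hc hd
        omega
      simp [etaFactor, hnd]
    · simp

/-- The coefficients of `f` equally populate the nonzero residue classes mod `p`: any two nonzero
classes contain the same number of coefficients of `f`, counted with multiplicity (that is,
by the exponents `t` at which they occur). -/
def EquallyPopulates (p : ℕ) (f : ℤ[X]) : Prop :=
  ∀ r s : ZMod p, r ≠ 0 → s ≠ 0 →
    (f.support.filter fun t => (f.coeff t : ZMod p) = r).card =
      (f.support.filter fun t => (f.coeff t : ZMod p) = s).card

/-! Write $P_n$ for `etaPoly n`. Modulo $p$ its recursion truncates, so $P_{pa+r}=P_p^a P_r$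
(`etaPolyMod_mul_add`, `etaPolyMod_mul`). Since $p!$ divides $P_p$ at positive integers,
$P_p\equiv-(X^p-X)$ (`etaPolyMod_self`). Hence $P_{pa+p-1}\equiv(-1)^a(X^p-X)^aP_{p-1}$, where
$P_{p-1}$ has leading coefficient $1$ and, by Wilson, constant term $c=-\#\{\text{partitions of
}p-1\}$.

As $X^p-X=X(X^{p-1}-1)$, sorting exponents mod $p-1$ leaves scalar multiples of $(X-1)^a$ and one
copy of $(X-1)^a(X+c)$. It suffices that multiplying by any unit permutes the coefficients of both
(`ScaleInvariant`). For $a=pA+p-2$ these come in blocks of $p$, each a multiple of the coefficients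
of $(X-1)^{p-2}$, resp. $(X-1)^{p-2}(X+c)$. These are affine in $j<p$, with nonzero slope (for the
second, when $c\ne-1$), so they run through all residues. If $c=-1$, the second polynomial is
$(X-1)^{a+1}$; taking $a=p(pA+p-2)+p-2$ makes it invariant too, because $(X-1)^{p-1}$ has all
coefficients $1$. -/

/-- Integer form of the polynomials `n! [q ^ n] ∏ (1 - q ^ k) ^ (b - 1)`, given by the recursion
coming from the logarithmic derivative of the product. -/
noncomputable def etaPoly : ℕ → ℤ[X]
  | 0 => 1
  | n + 1 => (1 - X) * ∑ m : Fin (n + 1),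
      (((∑ d ∈ (m.val + 1).divisors, d) * n.descFactorial m : ℕ) : ℤ[X]) * etaPoly (n - m)
  decreasing_by omega

theorem etaPoly_zero : etaPoly 0 = 1 := by rw [etaPoly]

theorem etaPoly_succ (n : ℕ) : etaPoly (n + 1) = (1 - X) * ∑ m ∈ Finset.range (n + 1),
    (((∑ d ∈ (m + 1).divisors, d) * n.descFactorial m : ℕ) : ℤ[X]) * etaPoly (n - m) := by
  rw [etaPoly, ← Fin.sum_univ_eq_sum_range
    (fun m => (((∑ d ∈ (m + 1).divisors, d) * n.descFactorial m : ℕ) : ℤ[X]) * etaPoly (n - m))]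

/-! ### Logarithmic derivative of the product. -/

theorem succ_mul_binomBSubOne_succ (i : ℕ) :
    ((i + 1 : ℕ) : ℚ[X]) * binomBSubOne (i + 1) = (X - 1 - (i : ℚ[X])) * binomBSubOne i := by
  have h : ((i + 1 : ℕ) : ℚ[X]) * C (((i + 1).factorial : ℚ)⁻¹) = C ((i.factorial : ℚ)⁻¹) := by
    rw [← C_eq_natCast, ← C_mul, Nat.factorial_succ]
    congr 1
    have := Nat.factorial_ne_zero i
    push_cast
    field_simp
  rw [binomBSubOne, ← mul_assoc, h, binomBSubOne, descPochhammer_succ_right]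
  simp only [mul_comp, sub_comp, X_comp, natCast_comp]
  ring

/-- The series `∑ k q ^ (k j)` over `j ≥ 1`. -/
noncomputable def multiplesSeries (k : ℕ) : PowerSeries ℚ[X] :=
  PowerSeries.mk fun m => if m ≠ 0 ∧ k ∣ m then (k : ℚ[X]) else 0

theorem coeff_X_mul_derivative (F : PowerSeries ℚ[X]) (m : ℕ) :
    PowerSeries.coeff m (PowerSeries.X * PowerSeries.derivative ℚ[X] F) =
      (m : ℚ[X]) * PowerSeries.coeff m F := by
  cases m with
  | zero => simp
  | succ m =>
    rw [mul_comm, PowerSeries.coeff_succ_mul_X, PowerSeries.coeff_derivative]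
    push_cast
    ring

theorem one_sub_X_pow_mul_multiplesSeries {k : ℕ} (hk : 0 < k) :
    (1 - PowerSeries.X ^ k) * multiplesSeries k =
      (k : PowerSeries ℚ[X]) * PowerSeries.X ^ k := by
  ext1 m
  rw [sub_mul, one_mul, map_sub, PowerSeries.coeff_X_pow_mul', ← map_natCast (PowerSeries.C),
    PowerSeries.coeff_C_mul, PowerSeries.coeff_X_pow]
  simp only [multiplesSeries, PowerSeries.coeff_mk]
  rcases lt_trichotomy m k with h | rfl | h
  · have : ¬ (m ≠ 0 ∧ k ∣ m) := fun ⟨h1, h2⟩ => by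
      have := Nat.le_of_dvd (Nat.pos_of_ne_zero h1) h2
      omega
    simp [this, h.ne, not_le.2 h]
  · simp [hk.ne']
  · obtain ⟨j, rfl⟩ := Nat.exists_eq_add_of_lt h
    have : k ∣ k + j + 1 ↔ k ∣ j + 1 := by
      rw [add_assoc, Nat.dvd_add_right (dvd_refl k)]
    have h3 : k + j + 1 - k = j + 1 := by omega
    have h4 : k ≤ k + j + 1 := by omega
    have h5 : k + j + 1 ≠ k := by omega
    simp [this, h3, h4, h5]

/-- The logarithmic derivative $(1-b)kq^k/(1-q^k)$ with its denominator cleared; coefficientwise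
this is the binomial recursion. -/
theorem one_sub_X_pow_mul_derivative_etaFactor {k : ℕ} (hk : 0 < k) :
    (1 - PowerSeries.X ^ k) * (PowerSeries.X * PowerSeries.derivative ℚ[X] (etaFactor k)) =
      PowerSeries.C (1 - X : ℚ[X]) * ((k : PowerSeries ℚ[X]) * PowerSeries.X ^ k) *
        etaFactor k := by
  ext1 m
  rw [sub_mul, one_mul, map_sub, PowerSeries.coeff_X_pow_mul', ← map_natCast (PowerSeries.C),
    ← mul_assoc, ← map_mul, mul_assoc, PowerSeries.coeff_C_mul, PowerSeries.coeff_X_pow_mul']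
  simp only [coeff_X_mul_derivative]
  by_cases h : k ≤ m
  · obtain ⟨j, rfl⟩ := Nat.exists_eq_add_of_le' h
    simp only [h, if_true, Nat.add_sub_cancel, etaFactor, PowerSeries.coeff_mk,
      Nat.dvd_add_self_right]
    by_cases hd : k ∣ j
    · obtain ⟨i, rfl⟩ := hd
      have h1 : (k * i + k) / k = i + 1 := by
        rw [← Nat.mul_succ, Nat.mul_div_cancel_left _ hk]
      have h2 := succ_mul_binomBSubOne_succ i
      simp only [h1, Nat.mul_div_cancel_left _ hk, dvd_mul_right, if_true]
      push_cast at h2 ⊢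
      linear_combination (-1) ^ (i + 1) * (k : ℚ[X]) * h2
    · simp [hd]
  · have : m ≠ 0 → ¬ k ∣ m := fun h1 h2 => h (Nat.le_of_dvd (Nat.pos_of_ne_zero h1) h2)
    by_cases hm : m = 0
    · simp [hm, hk.ne']
    · simp [h, this hm, etaFactor]

theorem X_mul_derivative_etaFactor {k : ℕ} (hk : 0 < k) :
    PowerSeries.X * PowerSeries.derivative ℚ[X] (etaFactor k) =
      PowerSeries.C (1 - X : ℚ[X]) * multiplesSeries k * etaFactor k := by
  have h0 : (1 - PowerSeries.X ^ k : PowerSeries ℚ[X]) ≠ 0 := fun h => by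
    have := congrArg PowerSeries.constantCoeff h
    simp [hk.ne'] at this
  refine mul_left_cancel₀ h0 ?_
  rw [one_sub_X_pow_mul_derivative_etaFactor hk, ← one_sub_X_pow_mul_multiplesSeries hk]
  ring

theorem derivative_mul_eq {R : Type*} [CommRing R] (F G : PowerSeries R) :
    PowerSeries.derivative R (F * G) =
      F * PowerSeries.derivative R G + G * PowerSeries.derivative R F := by
  rw [Derivation.leibniz, smul_eq_mul, smul_eq_mul]

theorem X_mul_derivative_prod_etaFactor (N : ℕ) :
    PowerSeries.X * PowerSeries.derivative ℚ[X] (∏ k ∈ Finset.Icc 1 N, etaFactor k) =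
      PowerSeries.C (1 - X : ℚ[X]) * (∑ k ∈ Finset.Icc 1 N, multiplesSeries k) *
        ∏ k ∈ Finset.Icc 1 N, etaFactor k := by
  induction N with
  | zero => simp
  | succ N ih =>
    rw [Finset.prod_Icc_succ_top (by omega), Finset.sum_Icc_succ_top (by omega),
      derivative_mul_eq]
    linear_combination etaFactor (N + 1) * ih +
      (∏ k ∈ Finset.Icc 1 N, etaFactor k) * X_mul_derivative_etaFactor N.succ_pos

theorem coeff_sum_multiplesSeries {N m : ℕ} (hm : m + 1 ≤ N) :
    PowerSeries.coeff (m + 1) (∑ k ∈ Finset.Icc 1 N, multiplesSeries k) =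
      ((∑ d ∈ (m + 1).divisors, d : ℕ) : ℚ[X]) := by
  simp only [map_sum, multiplesSeries, PowerSeries.coeff_mk, ne_eq, Nat.succ_ne_zero,
    not_false_eq_true, true_and]
  rw [← Finset.sum_filter, Nat.cast_sum]
  refine Finset.sum_congr ?_ fun _ _ => rfl
  ext d
  simp only [Finset.mem_filter, Finset.mem_Icc, Nat.mem_divisors]
  constructor
  · exact fun h => ⟨h.2, by omega⟩
  · intro h
    have := Nat.le_of_dvd (by omega) h.1
    exact ⟨⟨Nat.pos_of_dvd_of_pos h.1 (by omega), by omega⟩, h.1⟩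

theorem succ_mul_coeff_etaPower (n : ℕ) :
    ((n + 1 : ℕ) : ℚ[X]) * PowerSeries.coeff (n + 1) etaPower =
      (1 - X) * ∑ m ∈ Finset.range (n + 1), ((∑ d ∈ (m + 1).divisors, d : ℕ) : ℚ[X]) *
        PowerSeries.coeff (n - m) etaPower := by
  have h := congrArg (PowerSeries.coeff (n + 1)) (X_mul_derivative_prod_etaFactor (n + 1))
  rw [coeff_X_mul_derivative, coeff_etaPower _ _ le_rfl, mul_assoc, PowerSeries.coeff_C_mul,
    PowerSeries.coeff_mul, Finset.Nat.sum_antidiagonal_eq_sum_range_succ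
      (fun i j => PowerSeries.coeff i (∑ k ∈ Finset.Icc 1 (n + 1), multiplesSeries k) *
        PowerSeries.coeff j (∏ k ∈ Finset.Icc 1 (n + 1), etaFactor k)),
    Finset.sum_range_succ'] at h
  have h0 : PowerSeries.coeff 0 (∑ k ∈ Finset.Icc 1 (n + 1), multiplesSeries k) = 0 := by
    rw [map_sum]
    exact Finset.sum_eq_zero fun k _ => by simp [multiplesSeries]
  rw [h, h0, zero_mul, add_zero]
  refine congrArg ((1 - X) * ·) (Finset.sum_congr rfl fun m hm => ?_)
  rw [Finset.mem_range] at hm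
  rw [coeff_sum_multiplesSeries (by omega), coeff_etaPower _ _ (by omega),
    Nat.add_sub_add_right]

theorem map_etaPoly (n : ℕ) : (etaPoly n).map (Int.castRingHom ℚ) =
    C (n.factorial : ℚ) * PowerSeries.coeff n etaPower := by
  induction n using Nat.strong_induction_on with
  | _ n ih =>
    cases n with
    | zero => simp [etaPoly_zero, etaPower]
    | succ n =>
      rw [etaPoly_succ, Nat.factorial_succ, Nat.cast_mul, C_mul, mul_comm (C _), mul_assoc,
        C_eq_natCast, C_eq_natCast, succ_mul_coeff_etaPower]
      simp only [Polynomial.map_mul, Polynomial.map_sub, Polynomial.map_one, map_X,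
        Polynomial.map_sum, Polynomial.map_natCast]
      rw [mul_left_comm, Finset.mul_sum, Finset.mul_sum, Finset.mul_sum]
      refine Finset.sum_congr rfl fun m hm => ?_
      rw [Finset.mem_range] at hm
      rw [ih _ (by omega), ← Nat.factorial_mul_descFactorial (show m ≤ n by omega), C_eq_natCast]
      push_cast
      ring

/-! ### Degree, leading coefficient and special values. -/

theorem natDegree_etaPoly_le (n : ℕ) : (etaPoly n).natDegree ≤ n := by
  induction n using Nat.strong_induction_on with
  | _ n ih =>
    cases n with
    | zero => simp [etaPoly_zero]
    | succ n =>
      rw [etaPoly_succ, add_comm]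
      refine natDegree_mul_le_of_le (by compute_degree) ?_
      refine natDegree_sum_le_of_forall_le _ _ fun m _ => ?_
      refine (natDegree_mul_le_of_le (natDegree_natCast _).le (ih (n - m) (by omega))).trans ?_
      omega

theorem coeff_etaPoly_self (n : ℕ) : (etaPoly n).coeff n = (-1) ^ n := by
  induction n with
  | zero => simp [etaPoly_zero]
  | succ n ih =>
    have h1 (m j : ℕ) (h : n - m < j) : (etaPoly (n - m)).coeff j = 0 :=
      coeff_eq_zero_of_natDegree_lt ((natDegree_etaPoly_le _).trans_lt h)
    rw [etaPoly_succ, sub_mul, one_mul, coeff_sub, coeff_X_mul, finsetSum_coeff,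
      finsetSum_coeff, Finset.sum_eq_zero, Finset.sum_eq_single 0]
    · simp [ih, pow_succ]
    · intro m hm hm0
      rw [Finset.mem_range] at hm
      rw [← C_eq_natCast, coeff_C_mul, h1 _ _ (by omega), mul_zero]
    · simp
    · intro m _
      rw [← C_eq_natCast, coeff_C_mul, h1 _ _ (by omega), mul_zero]

theorem eval_binomBSubOne_natCast_succ (N i : ℕ) :
    (binomBSubOne i).eval ((N : ℚ) + 1) = N.choose i := by
  have := Nat.factorial_ne_zero i
  rw [binomBSubOne, eval_mul, eval_C, eval_comp, eval_sub, eval_X, eval_one, add_sub_cancel_right,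
    descPochhammer_eval_eq_descFactorial, Nat.descFactorial_eq_factorial_mul_choose]
  push_cast
  field_simp

theorem eval_binomBSubOne_zero (i : ℕ) : (binomBSubOne i).eval 0 = (-1) ^ i := by
  induction i with
  | zero => simp [binomBSubOne]
  | succ i ih =>
    have h := congrArg (eval 0) (succ_mul_binomBSubOne_succ i)
    simp only [eval_mul, eval_natCast, eval_sub, eval_X, eval_one, ih] at h
    have h1 : ((i + 1 : ℕ) : ℚ) ≠ 0 := by positivity
    refine mul_left_cancel₀ h1 (h.trans ?_)
    push_cast
    ring

/-- At $b=N+1$ every factor is the integral polynomial $(1-q^k)^N$. -/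
theorem exists_int_eval_coeff_etaPower (N n : ℕ) :
    ∃ z : ℤ, (PowerSeries.coeff n etaPower).eval ((N : ℚ) + 1) = z := by
  have h (k : ℕ) : PowerSeries.map (evalRingHom ((N : ℚ) + 1)) (etaFactor k) =
      PowerSeries.map (Int.castRingHom ℚ) (PowerSeries.mk fun m =>
        if k ∣ m then (-1) ^ (m / k) * (N.choose (m / k) : ℤ) else 0) := by
    ext m
    simp only [PowerSeries.coeff_map, etaFactor, PowerSeries.coeff_mk]
    split_ifs
    · simp [eval_binomBSubOne_natCast_succ]
    · simp
  refine ⟨PowerSeries.coeff n (∏ k ∈ Finset.Icc 1 n, PowerSeries.mk fun m =>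
        if k ∣ m then (-1) ^ (m / k) * (N.choose (m / k) : ℤ) else 0), ?_⟩
  rw [← coeff_etaPower n n le_rfl, ← coe_evalRingHom, ← PowerSeries.coeff_map, map_prod]
  simp only [h]
  rw [← map_prod, PowerSeries.coeff_map, eq_intCast]

theorem factorial_dvd_eval_etaPoly (n N : ℕ) :
    (n.factorial : ℤ) ∣ (etaPoly n).eval ((N : ℤ) + 1) := by
  obtain ⟨z, hz⟩ := exists_int_eval_coeff_etaPower N n
  refine ⟨z, ?_⟩
  have h := congrArg (eval ((N : ℚ) + 1)) (map_etaPoly n)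
  rw [eval_mul, hz, eval_C, eval_map, show (N : ℚ) + 1 = Int.castRingHom ℚ ((N : ℤ) + 1) by simp,
    eval₂_at_apply, eq_intCast] at h
  exact_mod_cast h

open scoped PowerSeries.WithPiTopology in
-- At $b=0$ the product is $\prod 1/(1-q^k)$, the generating function of partitions.
theorem eval_zero_coeff_etaPower (n : ℕ) :
    (PowerSeries.coeff n etaPower).eval 0 = (Fintype.card n.Partition : ℚ) := by
  have h := (Nat.Partition.hasProd_genFun (R := ℚ) fun _ _ => 1).tendsto_prod_nat
  rw [PowerSeries.WithPiTopology.tendsto_iff_coeff_tendsto] at h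
  have hf (k : ℕ) : (1 + ∑' j, (1 : ℚ) • PowerSeries.X ^ ((k + 1) * (j + 1)) : PowerSeries ℚ) =
      PowerSeries.map (evalRingHom (0 : ℚ)) (etaFactor (k + 1)) := by
    ext m
    have hs := Nat.Partition.summable_genFun_term (R := ℚ) (fun _ _ => 1) k
    rw [map_add, hs.map_tsum _ (PowerSeries.WithPiTopology.continuous_coeff _ _),
      PowerSeries.coeff_map, etaFactor, PowerSeries.coeff_mk]
    simp only [one_smul, PowerSeries.coeff_X_pow, PowerSeries.coeff_one]
    split_ifs with h0 hd hd
    · subst h0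
      simp [eval_binomBSubOne_zero]
    · exact absurd (h0 ▸ dvd_zero _) hd
    · obtain ⟨j, rfl⟩ := hd
      obtain ⟨i, rfl⟩ : ∃ i, j = i + 1 := Nat.exists_eq_succ_of_ne_zero (by rintro rfl; simp at h0)
      rw [tsum_eq_single i]
      · simp [eval_binomBSubOne_zero, ← mul_pow]
      · intro b hb
        simp [hb.symm]
    · have (b : ℕ) : m ≠ (k + 1) * (b + 1) := by rintro rfl; simp at hd
      simp [this]
  have h2 := h n
  simp only [hf] at h2
  have h3 : Filter.Tendsto (fun N => PowerSeries.coeff n (∏ k ∈ Finset.range N,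
      PowerSeries.map (evalRingHom (0 : ℚ)) (etaFactor (k + 1)))) Filter.atTop
      (nhds ((PowerSeries.coeff n etaPower).eval 0)) := by
    refine tendsto_const_nhds.congr' ?_
    filter_upwards [Filter.eventually_ge_atTop n] with N hN
    rw [← map_prod, PowerSeries.coeff_map, ← coeff_etaPower n N hN, coe_evalRingHom,
      Finset.range_eq_Ico, Finset.prod_Ico_add' etaFactor]
    rfl
  rw [tendsto_nhds_unique h3 h2]
  simp [Nat.Partition.genFun, Finsupp.prod]

theorem coeff_zero_etaPoly (n : ℕ) :
    (etaPoly n).coeff 0 = n.factorial * Fintype.card n.Partition := by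
  have h := congrArg (eval 0) (map_etaPoly n)
  rw [eval_mul, eval_zero_coeff_etaPower, eval_C, ← coeff_zero_eq_eval_zero, coeff_map,
    eq_intCast] at h
  exact_mod_cast h

/-! ### Reduction modulo `p`. -/

/-- The reduction of `etaPoly n` modulo `p`. -/
noncomputable def etaPolyMod (p n : ℕ) : (ZMod p)[X] :=
  (etaPoly n).map (Int.castRingHom (ZMod p))

section
variable {p : ℕ}

theorem etaPolyMod_succ (n : ℕ) : etaPolyMod p (n + 1) = (1 - X) * ∑ m ∈ Finset.range (n + 1),
    C (((∑ d ∈ (m + 1).divisors, d : ℕ) : ZMod p) * (n.descFactorial m : ZMod p)) *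
      etaPolyMod p (n - m) := by
  simp only [etaPolyMod, etaPoly_succ, Polynomial.map_mul, Polynomial.map_sub, Polynomial.map_one,
    map_X, Polynomial.map_sum, Polynomial.map_natCast, ← Nat.cast_mul, C_eq_natCast]

/-- Descending factorials of $pa+r$ and $r$ agree mod $p$, and those of $r$ vanish beyond $m=r$, so
both sides obey the same recursion. -/
theorem etaPolyMod_mul_add (a : ℕ) {r : ℕ} (hr : r ≤ p) :
    etaPolyMod p (p * a + r) = etaPolyMod p (p * a) * etaPolyMod p r := by
  induction r using Nat.strong_induction_on with
  | _ r ih =>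
    cases r with
    | zero => simp [etaPolyMod, etaPoly_zero]
    | succ r =>
      have hd (m : ℕ) : ((p * a + r).descFactorial m : ZMod p) = (r.descFactorial m : ZMod p) := by
        rw [← descPochhammer_eval_eq_descFactorial, ← descPochhammer_eval_eq_descFactorial]
        simp
      rw [← add_assoc, etaPolyMod_succ, etaPolyMod_succ, mul_left_comm,
        Finset.mul_sum, Finset.mul_sum, Finset.mul_sum]
      rw [← Finset.sum_subset (Finset.range_mono (show r + 1 ≤ p * a + r + 1 by omega))]
      · refine Finset.sum_congr rfl fun m hm => ?_
        rw [Finset.mem_range] at hm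
        rw [hd, Nat.add_sub_assoc (by omega), ih (r - m) (by omega) (by omega)]
        ring
      · intro m _ hm
        rw [Finset.mem_range] at hm
        rw [hd, Nat.descFactorial_of_lt (by omega)]
        simp

theorem etaPolyMod_mul (a : ℕ) : etaPolyMod p (p * a) = etaPolyMod p p ^ a := by
  induction a with
  | zero => simp [etaPolyMod, etaPoly_zero]
  | succ a ih => rw [Nat.mul_succ, etaPolyMod_mul_add a le_rfl, ih, pow_succ]

theorem natDegree_etaPolyMod_le (n : ℕ) : (etaPolyMod p n).natDegree ≤ n :=
  natDegree_map_le.trans (natDegree_etaPoly_le n)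

theorem coeff_etaPolyMod_self (n : ℕ) : (etaPolyMod p n).coeff n = (-1) ^ n := by
  simp [etaPolyMod, coeff_map, coeff_etaPoly_self]

variable [hp : Fact p.Prime]

theorem eval_etaPolyMod_self (x : ZMod p) : (etaPolyMod p p).eval x = 0 := by
  obtain ⟨N, hN⟩ := ZMod.natCast_zmod_surjective (x - 1)
  have hx : x = Int.castRingHom (ZMod p) ((N : ℤ) + 1) := by simp [hN]
  rw [hx, etaPolyMod, eval_map, eval₂_at_apply, eq_intCast, ZMod.intCast_zmod_eq_zero_iff_dvd]
  refine dvd_trans ?_ (factorial_dvd_eval_etaPoly p N)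
  exact_mod_cast Nat.dvd_factorial hp.out.pos le_rfl

theorem etaPolyMod_self : etaPolyMod p p = -(X ^ p - X) := by
  have h1 := hp.out.one_lt
  have h : etaPolyMod p p + (X ^ p - X) = 0 := by
    refine eq_zero_of_natDegree_lt_card_of_eval_eq_zero _ (ι := ZMod p) (f := id)
      Function.injective_id (fun x => ?_) ?_
    · simp [eval_etaPolyMod_self, ZMod.pow_card]
    · rw [ZMod.card]
      have hle : (etaPolyMod p p + (X ^ p - X)).natDegree ≤ p := by
        refine natDegree_add_le_of_degree_le (natDegree_etaPolyMod_le p) ?_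
        compute_degree
        omega
      refine hle.lt_of_ne fun hdeg => ?_
      have hc : (etaPolyMod p p + (X ^ p - X)).leadingCoeff = 0 := by
        -- `ZMod.pow_card` gives $(-1)^p=-1$ for every prime, including $2$.
        rw [leadingCoeff, hdeg, coeff_add, coeff_etaPolyMod_self, ZMod.pow_card, coeff_sub,
          coeff_X_pow_self, coeff_X_of_ne_one h1.ne', sub_zero, neg_add_cancel]
      rw [leadingCoeff_eq_zero.1 hc, natDegree_zero] at hdeg
      omega
  exact eq_neg_of_add_eq_zero_left h

theorem coeff_etaPolyMod_pred_self : (etaPolyMod p (p - 1)).coeff (p - 1) = 1 := by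
  rw [coeff_etaPolyMod_self]
  exact ZMod.pow_card_sub_one_eq_one (by simp)

theorem coeff_zero_etaPolyMod_pred :
    (etaPolyMod p (p - 1)).coeff 0 = -(Fintype.card (p - 1).Partition : ZMod p) := by
  simp [etaPolyMod, coeff_map, coeff_zero_etaPoly, ZMod.wilsons_lemma]

end

/-! ### Scale invariant families. -/

/-- A family of elements of a monoid is scale invariant if multiplication by any unit permutes it,
that is, if all associated elements occur in it equally often. -/
def ScaleInvariant {ι F : Type*} [CommMonoid F] (c : ι → F) : Prop :=
  ∀ u : Fˣ, ∃ e : Equiv.Perm ι, ∀ t, c (e t) = u * c t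

namespace ScaleInvariant

variable {ι κ F : Type*}

section
variable [CommMonoid F]

theorem of_comp_equiv {c : κ → F} (φ : ι ≃ κ) (h : ScaleInvariant fun t => c (φ t)) :
    ScaleInvariant c := fun u => by
  obtain ⟨e, he⟩ := h u
  exact ⟨φ.permCongr e, fun t => by simp [he]⟩

theorem of_forall_left {c : ι × κ → F} (h : ∀ i, ScaleInvariant fun j => c (i, j)) :
    ScaleInvariant c := fun u => by
  choose e he using fun i => h i u
  exact ⟨Equiv.prodCongrRight e, fun t => he t.1 t.2⟩

theorem of_forall_right {c : ι × κ → F} (h : ∀ j, ScaleInvariant fun i => c (i, j)) :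
    ScaleInvariant c := fun u => by
  choose e he using fun j => h j u
  exact ⟨Equiv.prodCongrLeft e, fun t => he t.2 t.1⟩

theorem const_mul {c : ι → F} (h : ScaleInvariant c) (a : F) :
    ScaleInvariant fun t => a * c t := fun u => by
  obtain ⟨e, he⟩ := h u
  exact ⟨e, fun t => by simp only [he, mul_left_comm]⟩

theorem sumElim {c : ι → F} {d : κ → F} (hc : ScaleInvariant c) (hd : ScaleInvariant d) :
    ScaleInvariant (Sum.elim c d) := fun u => by
  obtain ⟨e, he⟩ := hc u
  obtain ⟨f, hf⟩ := hd u
  exact ⟨Equiv.sumCongr e f, by rintro (t | t) <;> simp [he, hf]⟩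

theorem of_bijective {c : ι → F} (h : Function.Bijective c) : ScaleInvariant c := fun u => by
  let φ := Equiv.ofBijective c h
  refine ⟨(φ.trans (Units.mulLeft u)).trans φ.symm, fun t => ?_⟩
  exact φ.apply_symm_apply _

end

theorem zero [CommMonoidWithZero F] : ScaleInvariant fun _ : ι => (0 : F) :=
  fun _ => ⟨Equiv.refl _, fun _ => by simp⟩

end ScaleInvariant

/-! ### Scale invariance of polynomial coefficients. -/

section
variable {R : Type*} [CommRing R]

/-- By uniqueness of division by $d$, the coefficients form the table $w_iv_j$; invariance of either
factor then suffices. -/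
theorem coeff_expand_mul_add {d : ℕ} (w : R[X]) {v : R[X]} (hv : v.natDegree < d) (i : ℕ) {j : ℕ}
    (hj : j < d) : (expand R d w * v).coeff (i * d + j) = w.coeff i * v.coeff j := by
  have hd : 0 < d := by omega
  rw [coeff_mul, Finset.sum_eq_single (i * d, j)]
  · rw [coeff_expand_mul hd]
  · rintro ⟨a, b⟩ hab hne
    rw [Finset.HasAntidiagonal.mem_antidiagonal] at hab
    dsimp only at hab ⊢
    rw [coeff_expand hd]
    split_ifs with h
    · obtain ⟨k, rfl⟩ := h
      rcases lt_or_ge b d with hb | hb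
      · have h1 : b = j := by
          have := congrArg (· % d) hab
          simpa [Nat.mod_eq_of_lt hb, Nat.mod_eq_of_lt hj] using this
        refine absurd ?_ hne
        subst h1
        rw [Prod.mk.injEq]
        omega
      · rw [coeff_eq_zero_of_natDegree_lt (hv.trans_le hb), mul_zero]
    · rw [zero_mul]
  · simp

theorem ScaleInvariant.coeff_expand_mul_of_left {d : ℕ} {w v : R[X]} (hv : v.natDegree < d)
    (hw : ScaleInvariant w.coeff) : ScaleInvariant (expand R d w * v).coeff := by
  have : NeZero d := ⟨by omega⟩
  refine .of_comp_equiv (Nat.divModEquiv d).symm (.of_forall_right fun j => ?_)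
  simp only [Nat.divModEquiv_symm_apply, coeff_expand_mul_add w hv _ j.isLt, mul_comm (w.coeff _)]
  exact hw.const_mul _

theorem ScaleInvariant.coeff_expand_mul_of_right {d : ℕ} {w v : R[X]} (hv : v.natDegree < d)
    (h : ScaleInvariant fun j : Fin d => v.coeff j) : ScaleInvariant (expand R d w * v).coeff := by
  have : NeZero d := ⟨by omega⟩
  refine .of_comp_equiv (Nat.divModEquiv d).symm (.of_forall_left fun i => ?_)
  simp only [Nat.divModEquiv_symm_apply, coeff_expand_mul_add w hv _ (Fin.isLt _)]
  exact h.const_mul _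

theorem ScaleInvariant.coeff_sum_expand_mul_X_pow {d : ℕ} [NeZero d] {g : ℕ → R[X]}
    (h : ∀ s < d, ScaleInvariant (g s).coeff) :
    ScaleInvariant (∑ s ∈ Finset.range d, expand R d (g s) * X ^ s).coeff := by
  refine .of_comp_equiv (Nat.divModEquiv d).symm (.of_forall_right fun j => ?_)
  refine (congrArg ScaleInvariant (funext fun i => ?_)).mpr (h j j.isLt)
  rw [Nat.divModEquiv_symm_apply, finsetSum_coeff, Finset.sum_eq_single j.val]
  · rw [coeff_expand_mul_add _ ((natDegree_X_pow_le _).trans_lt j.isLt) _ j.isLt]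
    simp
  · intro s hs hsj
    rw [Finset.mem_range] at hs
    rw [coeff_expand_mul_add _ ((natDegree_X_pow_le _).trans_lt hs) _ j.isLt, coeff_X_pow,
      if_neg hsj.symm, mul_zero]
  · simp

theorem ScaleInvariant.coeff_C_mul {f : R[X]} (h : ScaleInvariant f.coeff) (a : R) :
    ScaleInvariant (C a * f).coeff := by
  refine (congrArg ScaleInvariant (funext fun t => ?_)).mpr (h.const_mul a)
  rw [Polynomial.coeff_C_mul]

theorem ScaleInvariant.coeff_mul_X_pow {f : R[X]} (h : ScaleInvariant f.coeff) (a : ℕ) :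
    ScaleInvariant (f * X ^ a).coeff := by
  refine .of_comp_equiv (finSumNatEquiv a) ?_
  refine (congrArg ScaleInvariant (funext fun t => ?_)).mpr
    (ScaleInvariant.sumElim (ScaleInvariant.zero (ι := Fin a)) h)
  rcases t with t | t
  · simp [coeff_mul_X_pow']
  · simp [coeff_mul_X_pow']

end

theorem equallyPopulates_of_scaleInvariant {p : ℕ} [Fact p.Prime] {f : ℤ[X]}
    (h : ScaleInvariant (f.map (Int.castRingHom (ZMod p))).coeff) : EquallyPopulates p f := by
  intro r s hr hs
  obtain ⟨e, he⟩ := h (Units.mk0 (s / r) (div_ne_zero hs hr))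
  simp only [coeff_map, eq_intCast, Units.val_mk0] at he
  have hmem {r : ZMod p} (hr : r ≠ 0) (t : ℕ) :
      t ∈ f.support.filter (fun t => (f.coeff t : ZMod p) = r) ↔ (f.coeff t : ZMod p) = r := by
    rw [Finset.mem_filter, mem_support_iff, and_iff_right_iff_imp]
    rintro h1 h2
    simp [h2, hr.symm] at h1
  refine Finset.card_equiv e fun t => ?_
  rw [hmem hr, hmem hs, he, div_mul_eq_mul_div, div_eq_iff hr, mul_right_inj' hs]

/-! ### Powers of `X - 1` modulo `p`, and the splitting of exponents mod `p - 1`. -/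

section
variable {p : ℕ} [hp : Fact p.Prime]

theorem X_sub_one_pow_pred : (X - 1 : (ZMod p)[X]) ^ (p - 1) = ∑ i ∈ Finset.range p, X ^ i := by
  refine mul_right_cancel₀ (X_sub_C_ne_zero (1 : ZMod p)) ?_
  rw [C_1, ← pow_succ, Nat.sub_add_cancel hp.out.one_le, geom_sum_mul, sub_pow_char, one_pow]

theorem coeff_X_sub_one_pow_pred {j : ℕ} (hj : j < p) :
    ((X - 1 : (ZMod p)[X]) ^ (p - 1)).coeff j = 1 := by
  simp [X_sub_one_pow_pred, coeff_X_pow, hj]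

theorem coeff_X_sub_one_pow_sub_two {j : ℕ} (hj : j < p) :
    ((X - 1 : (ZMod p)[X]) ^ (p - 2)).coeff j = -((j : ZMod p) + 1) := by
  have h : derivative ((X - 1 : (ZMod p)[X]) ^ (p - 1)) = -(X - 1) ^ (p - 2) := by
    rw [derivative_pow, show p - 1 - 1 = p - 2 by omega, Nat.cast_sub hp.out.one_le]
    simp
  have h2 := congrArg (coeff · j) h
  simp only [coeff_derivative, coeff_neg] at h2
  rw [eq_neg_iff_add_eq_zero, ← neg_eq_iff_add_eq_zero, ← h2]
  -- At $j=p-1$ the factor $j+1$ from the derivative is zero mod $p$.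
  rcases Nat.lt_or_ge (j + 1) p with h3 | h3
  · rw [coeff_X_sub_one_pow_pred h3, one_mul]
  · obtain rfl : p = j + 1 := by omega
    have : (j : ZMod (j + 1)) + 1 = 0 := by exact_mod_cast ZMod.natCast_self (j + 1)
    rw [this, mul_zero]

theorem natDegree_X_sub_one_pow_lt {k : ℕ} (hk : k < p) :
    ((X - 1 : (ZMod p)[X]) ^ k).natDegree < p := by
  rwa [← C_1, natDegree_pow, natDegree_X_sub_C, mul_one]

theorem X_sub_one_pow_mul_add (A k : ℕ) : (X - 1 : (ZMod p)[X]) ^ (p * A + k) =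
    expand (ZMod p) p ((X - 1) ^ A) * (X - 1) ^ k := by
  rw [ZMod.expand_card, ← pow_mul, mul_comm A, pow_add]

theorem bijective_mul_add {α β : ZMod p} (hβ : β ≠ 0) :
    Function.Bijective fun j : Fin p => β * (j : ZMod p) + α := by
  rw [Fintype.bijective_iff_injective_and_card]
  refine ⟨fun i j hij => ?_, by simp [ZMod.card]⟩
  have h := mul_left_cancel₀ hβ (add_right_cancel hij)
  rw [ZMod.natCast_eq_natCast_iff'] at h
  simpa [Nat.mod_eq_of_lt, Fin.ext_iff] using h

theorem scaleInvariant_coeff_X_sub_one_pow (A : ℕ) :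
    ScaleInvariant ((X - 1 : (ZMod p)[X]) ^ (p * A + (p - 2))).coeff := by
  have hp2 := hp.out.two_le
  rw [X_sub_one_pow_mul_add]
  refine .coeff_expand_mul_of_right (natDegree_X_sub_one_pow_lt (by omega)) ?_
  refine .of_bijective ?_
  convert bijective_mul_add (p := p) (α := -1) (β := -1) (by simp) with j
  rw [coeff_X_sub_one_pow_sub_two j.isLt]
  ring

theorem scaleInvariant_coeff_X_sub_one_pow_mul_X_add (A : ℕ) {c : ZMod p} (hc : c ≠ -1) :
    ScaleInvariant ((X - 1 : (ZMod p)[X]) ^ (p * A + (p - 2)) * (X + C c)).coeff := by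
  have hp2 := hp.out.two_le
  have h : (X - 1 : (ZMod p)[X]) ^ (p - 2) * (X + C c) =
      (X - 1) ^ (p - 1) + C (c + 1) * (X - 1) ^ (p - 2) := by
    rw [show p - 1 = p - 2 + 1 by omega, pow_succ, C_add, C_1]
    ring
  rw [X_sub_one_pow_mul_add, mul_assoc, h]
  refine .coeff_expand_mul_of_right ?_ (.of_bijective ?_)
  · refine (natDegree_add_le _ _).trans_lt (max_lt (natDegree_X_sub_one_pow_lt (by omega)) ?_)
    exact (natDegree_C_mul_le _ _).trans_lt (natDegree_X_sub_one_pow_lt (by omega))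
  · convert bijective_mul_add (p := p) (α := -c) (β := -(c + 1))
      (neg_ne_zero.2 fun h => hc (eq_neg_of_add_eq_zero_left h)) with j
    rw [coeff_add, coeff_C_mul, coeff_X_sub_one_pow_sub_two j.isLt,
      coeff_X_sub_one_pow_pred j.isLt]
    ring

theorem scaleInvariant_coeff_X_sub_one_pow_pred (A : ℕ) :
    ScaleInvariant ((X - 1 : (ZMod p)[X]) ^ (p * (p * A + (p - 2)) + (p - 1))).coeff := by
  have hp2 := hp.out.two_le
  rw [X_sub_one_pow_mul_add]
  exact .coeff_expand_mul_of_left (natDegree_X_sub_one_pow_lt (by omega))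
    (scaleInvariant_coeff_X_sub_one_pow A)

/-- The leading term $X^{p-1}$ of $P_{p-1}$ joins the constant term in the class $s=0$, whence $X+c$
there. -/
theorem etaPolyMod_mul_add_pred (a : ℕ) : etaPolyMod p (p * a + (p - 1)) =
    C ((-1) ^ a) * ((∑ s ∈ Finset.range (p - 1), expand (ZMod p) (p - 1)
      ((X - 1) ^ a * if s = 0 then X + C ((etaPolyMod p (p - 1)).coeff 0)
        else C ((etaPolyMod p (p - 1)).coeff s)) * X ^ s) * X ^ a) := by
  have hp2 := hp.out.two_le
  have h1 : (X ^ p - X : (ZMod p)[X]) = expand (ZMod p) (p - 1) (X - 1) * X := by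
    rw [map_sub, expand_X, map_one, sub_mul, ← pow_succ, Nat.sub_add_cancel hp.out.one_le, one_mul]
  have h2 : etaPolyMod p (p - 1) = ∑ s ∈ Finset.range (p - 1), expand (ZMod p) (p - 1)
      (if s = 0 then X + C ((etaPolyMod p (p - 1)).coeff 0)
        else C ((etaPolyMod p (p - 1)).coeff s)) * X ^ s := by
    conv_lhs => rw [as_sum_range_C_mul_X_pow' _ (Nat.lt_succ_of_le (natDegree_etaPolyMod_le _)),
      Finset.sum_range_succ, coeff_etaPolyMod_pred_self]
    obtain ⟨m, hm⟩ : ∃ m, p - 1 = m + 1 := ⟨p - 2, by omega⟩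
    generalize (etaPolyMod p (p - 1)).coeff = c
    rw [hm, Finset.sum_range_succ', Finset.sum_range_succ']
    simp
    ring
  rw [etaPolyMod_mul_add a (Nat.sub_le p 1), etaPolyMod_mul, etaPolyMod_self, neg_pow, h1]
  conv_lhs => rw [h2]
  simp only [map_mul, mul_assoc, ← Finset.mul_sum]
  simp only [map_pow, map_neg, map_one]
  ring

theorem scaleInvariant_coeff_etaPolyMod {a : ℕ}
    (h1 : ScaleInvariant ((X - 1 : (ZMod p)[X]) ^ a).coeff)
    (h2 : ScaleInvariant ((X - 1 : (ZMod p)[X]) ^ a *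
      (X + C (-(Fintype.card (p - 1).Partition : ZMod p)))).coeff) :
    ScaleInvariant (etaPolyMod p (p * a + (p - 1))).coeff := by
  have hp2 := hp.out.two_le
  have : NeZero (p - 1) := ⟨by omega⟩
  rw [etaPolyMod_mul_add_pred]
  refine .coeff_C_mul (.coeff_mul_X_pow (.coeff_sum_expand_mul_X_pow fun s _ => ?_) a) _
  split_ifs with hs
  · rwa [coeff_zero_etaPolyMod_pred]
  · rw [mul_comm]
    exact h1.coeff_C_mul _

end

theorem theorem3p3 :
    ∃ P : ℕ → ℤ[X],
      (∀ n : ℕ, (P n).map (Int.castRingHom ℚ) =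
        C (n.factorial : ℚ) * PowerSeries.coeff n etaPower) ∧
      ∀ p : ℕ, p.Prime →
        (¬ Fintype.card (Nat.Partition (p - 1)) ≡ 1 [MOD p] →
          ∀ n : ℕ, (n : ℤ) ≡ -(p : ℤ) - 1 [ZMOD (p : ℤ) ^ 2] → EquallyPopulates p (P n)) ∧
        (Fintype.card (Nat.Partition (p - 1)) ≡ 1 [MOD p] →
          ∀ n : ℕ, (n : ℤ) ≡ -(p : ℤ) ^ 2 - (p : ℤ) - 1 [ZMOD (p : ℤ) ^ 3] →
            EquallyPopulates p (P n)) := by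
  refine ⟨etaPoly, map_etaPoly, fun p hp => ?_⟩
  have : Fact p.Prime := ⟨hp⟩
  have hp2 := hp.two_le
  rw [← ZMod.natCast_eq_natCast_iff, Nat.cast_one]
  constructor
  · intro hcard n hn
    have hd : p ^ 2 ∣ n + p + 1 := by
      have h := hn.symm.dvd
      rw [show (n : ℤ) - (-(p : ℤ) - 1) = ((n + p + 1 : ℕ) : ℤ) by push_cast; ring] at h
      exact_mod_cast h
    obtain ⟨k, hk⟩ := hd
    obtain ⟨A, rfl⟩ : ∃ A, k = A + 1 := Nat.exists_eq_succ_of_ne_zero (by rintro rfl; simp at hk)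
    obtain ⟨q, rfl⟩ : ∃ q, p = q + 2 := ⟨p - 2, by omega⟩
    -- From $n+p+1=p^2(A+1)$: $n=pa+p-1$ with $a=pA+p-2$.
    have hn' : n = (q + 2) * ((q + 2) * A + (q + 2 - 2)) + (q + 2 - 1) := by
      simp only [Nat.add_sub_cancel, show q + 2 - 1 = q + 1 by omega]
      linarith
    rw [hn']
    refine equallyPopulates_of_scaleInvariant (scaleInvariant_coeff_etaPolyMod
      (scaleInvariant_coeff_X_sub_one_pow A) (scaleInvariant_coeff_X_sub_one_pow_mul_X_add A ?_))
    exact fun h => hcard (neg_injective h)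
  · intro hcard n hn
    have hd : p ^ 3 ∣ n + p ^ 2 + p + 1 := by
      have h := hn.symm.dvd
      rw [show (n : ℤ) - (-(p : ℤ) ^ 2 - (p : ℤ) - 1) = ((n + p ^ 2 + p + 1 : ℕ) : ℤ) by
        push_cast; ring] at h
      exact_mod_cast h
    obtain ⟨k, hk⟩ := hd
    obtain ⟨A, rfl⟩ : ∃ A, k = A + 1 := Nat.exists_eq_succ_of_ne_zero (by rintro rfl; simp at hk)
    obtain ⟨q, rfl⟩ : ∃ q, p = q + 2 := ⟨p - 2, by omega⟩
    have hn' : n = (q + 2) * ((q + 2) * ((q + 2) * A + (q + 2 - 2)) + (q + 2 - 2)) +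
        (q + 2 - 1) := by
      simp only [Nat.add_sub_cancel, show q + 2 - 1 = q + 1 by omega]
      linarith
    rw [hn']
    refine equallyPopulates_of_scaleInvariant (scaleInvariant_coeff_etaPolyMod
      (scaleInvariant_coeff_X_sub_one_pow _) ?_)
    -- Here $X+c=X-1$ raises the last base-$p$ digit of the exponent from $p-2$ to $p-1$.
    convert scaleInvariant_coeff_X_sub_one_pow_pred A using 2
    rw [hcard, C_neg, C_1, ← sub_eq_add_neg, ← pow_succ]
    rfl
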